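/- For a finite simple graph $G$ let $n_i$ be the number of vertices of degree $i$, let $m_{i,j}$ be the number of edges joining a vertex of degree $i$ to a vertex of degree $j$, and let $R(G)=\sum_{uv\in E(G)}\frac{1}{\sqrt{\deg(u)\deg(v)}}$ be the Randić index. An $n$-vertex graph is $c$-cyclic if it is connected and has $n+c-1$ edges. Define sets of $n$-vertex graphs by $$\begin{aligned} \Omega_1(n)&=\{G: n_3=8,\ n_2=n-8,\ m_{3,3}=11,\ m_{2,3}=2,\ m_{2,2}=n-9\},\\ \Omega_3(n)&=\{G: n_3=10,\ n_2=n-10,\ m_{3,3}=14,\ m_{2,3}=2,\ m_{2,2}=n-11\},\\ \Omega_5(n)&=\{G: n_1=0,\ n_4=1,\ n_3=6,\ n_2=n-7,\ m_{4,3}=4,\ m_{3,3}=6,\ m_{2,3}=2,\ m_{2,2}=n-8\},\\ \Omega_7(n)&=\{G: n_1=0,\ n_4=1,\ n_3=8,\ n_2=n-9,\ m_{4,3}=4,\ m_{3,3}=9,\ m_{2,3}=2,\ m_{2,2}=n-10\}. \end{aligned}$$ A graph in a class has the maximum Randić index if it maximizes $R$ over the class, and the second maximum if it is not a maximizer and maximizes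 $R$ over the non-maximizers of the class. (1) Let $n\ge 9$. Both $\Omega_1(n)$ and $\Omega_5(n)$ contain 5-cyclic graphs. Among the $n$-vertex 5-cyclic graphs, those with the maximum Randić index are exactly the ones in $\Omega_1(n)$, and those with the second maximum Randić index are exactly the ones in $\Omega_5(n)$. (2) Let $n\ge 11$. Both $\Omega_3(n)$ and $\Omega_7(n)$ contain 6-cyclic graphs. Among the $n$-vertex 6-cyclic graphs, those with the maximum Randić index are exactly the ones in $\Omega_3(n)$, and every one in $\Omega_7(n)$ has the second maximum Randić index. -/

import Mathlib

namespace RandicCyclic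

variable {V : Type*} [Fintype V]

open Classical in
/-- The Randić index `R(G) = ∑_{uv ∈ E(G)} 1 / √(deg u * deg v)`. -/
noncomputable def randicIndex (G : SimpleGraph V) : ℝ :=
  ∑ e ∈ G.edgeFinset,
    Sym2.lift ⟨fun u v => 1 / Real.sqrt ((G.degree u : ℝ) * (G.degree v : ℝ)),
      fun u v => by simp only [mul_comm]⟩ e

open Classical in
/-- `n_i(G)`: the number of vertices of degree `i`. -/
noncomputable def degCount (G : SimpleGraph V) (i : ℕ) : ℕ :=
  {v : V | G.degree v = i}.ncard

open Classical in
/-- `m_{i,j}(G)`: the number of edges joining a vertex of degree `i` to a vertex of degree `j`. -/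
noncomputable def edgeCount (G : SimpleGraph V) (i j : ℕ) : ℕ :=
  {e : Sym2 V | e ∈ G.edgeSet ∧ ∃ u v : V, e = s(u, v) ∧ G.degree u = i ∧ G.degree v = j}.ncard

end RandicCyclic

namespace RandicCyclic

/-- The `n`-vertex `c`-cyclic graphs: connected, with `n + c - 1` edges. -/
def cyclicGraphs (n c : ℕ) : Set (SimpleGraph (Fin n)) :=
  {G | G.Connected ∧ G.edgeSet.ncard + 1 = n + c}

/-- `n_3 = 8`, `n_2 = n - 8`. -/
def Upsilon1 (n : ℕ) : Set (SimpleGraph (Fin n)) :=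
  {G | degCount G 3 = 8 ∧ degCount G 2 + 8 = n}

/-- `n_3 = 10`, `n_2 = n - 10`. -/
def Upsilon3 (n : ℕ) : Set (SimpleGraph (Fin n)) :=
  {G | degCount G 3 = 10 ∧ degCount G 2 + 10 = n}

/-- `n_1 = 0`, `n_4 = 1`, `n_3 = 6`, `n_2 = n - 7`. -/
def Upsilon5 (n : ℕ) : Set (SimpleGraph (Fin n)) :=
  {G | degCount G 1 = 0 ∧ degCount G 4 = 1 ∧ degCount G 3 = 6 ∧ degCount G 2 + 7 = n}

/-- `n_1 = 0`, `n_4 = 1`, `n_3 = 8`, `n_2 = n - 9`. -/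
def Upsilon6 (n : ℕ) : Set (SimpleGraph (Fin n)) :=
  {G | degCount G 1 = 0 ∧ degCount G 4 = 1 ∧ degCount G 3 = 8 ∧ degCount G 2 + 9 = n}

/-- `m_{3,3} = 11`, `m_{2,3} = 2`, `m_{2,2} = n - 9`. -/
def Omega1 (n : ℕ) : Set (SimpleGraph (Fin n)) :=
  {G | G ∈ Upsilon1 n ∧ edgeCount G 3 3 = 11 ∧ edgeCount G 2 3 = 2 ∧ edgeCount G 2 2 + 9 = n}

/-- `m_{3,3} = 14`, `m_{2,3} = 2`, `m_{2,2} = n - 11`. -/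
def Omega3 (n : ℕ) : Set (SimpleGraph (Fin n)) :=
  {G | G ∈ Upsilon3 n ∧ edgeCount G 3 3 = 14 ∧ edgeCount G 2 3 = 2 ∧ edgeCount G 2 2 + 11 = n}

/-- `m_{4,3} = 4`, `m_{3,3} = 6`, `m_{2,3} = 2`, `m_{2,2} = n - 8`. -/
def Omega5 (n : ℕ) : Set (SimpleGraph (Fin n)) :=
  {G | G ∈ Upsilon5 n ∧ edgeCount G 4 3 = 4 ∧ edgeCount G 3 3 = 6 ∧ edgeCount G 2 3 = 2 ∧
    edgeCount G 2 2 + 8 = n}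

/-- `m_{4,3} = 4`, `m_{3,3} = 9`, `m_{2,3} = 2`, `m_{2,2} = n - 10`. -/
def Omega7 (n : ℕ) : Set (SimpleGraph (Fin n)) :=
  {G | G ∈ Upsilon6 n ∧ edgeCount G 4 3 = 4 ∧ edgeCount G 3 3 = 9 ∧ edgeCount G 2 3 = 2 ∧
    edgeCount G 2 2 + 10 = n}

/-- `G` belongs to the class `C` and has the maximum Randić index in it. -/
def HasMaxRandic {n : ℕ} (C : Set (SimpleGraph (Fin n))) (G : SimpleGraph (Fin n)) : Prop :=
  G ∈ C ∧ ∀ H ∈ C, randicIndex H ≤ randicIndex G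

/-- `G` belongs to the class `C` and has the second maximum Randić index in it: `G` is not a
maximizer, and `R(G)` is the largest value of `R` on the members of `C` that are not maximizers. -/
def HasSecondMaxRandic {n : ℕ} (C : Set (SimpleGraph (Fin n))) (G : SimpleGraph (Fin n)) : Prop :=
  HasMaxRandic {H | H ∈ C ∧ ¬ HasMaxRandic C H} G

end RandicCyclic

/-! Write w(i,j) = (1/√i - 1/√j)². Expanding the square and using that each non-isolated vertex v
contributes deg(v) · 1/deg(v) = 1 gives 2R(G) = n - ∑ w(deg u, deg v) over the edges uv
(`four_mul_randicIndex`), so maximizing R means minimizing this penalty.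

Since 2n < ∑ deg = 2n + 2c - 2 < 3n, degrees below and above the 2/3 threshold both occur. By
connectedness a leaf forces an edge of cost at least w(1,2), which is too much. Otherwise the number
of edges from degree 2 to degree at least 3 is positive, and even because 2n₂ = 2m₂₂ + that number.
Two such edges, both ending in degree 3, and no degree above 3 give the minimum 2w(2,3). If the only
other change is that x ≥ 1 vertices have degree at least 4, at least 4x - x(x-1) = x(5-x) ≥ 4 edges
join them to degree 3, adding at least 4w(3,4); every remaining case costs strictly more
(`edgeWeight_estimates`, `cyclic_trichotomy`).

The degree budget gives x ≤ 4 for c = 6 and x ≤ 3 for c = 5. As x(5-x) = 4 only for x = 1 and x = 4,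
equality pins down the structure when c = 5, but the argument does not do so when c = 6; hence the
one-sided second claim in (2). A cycle with parallel chords shows that both values are attained. -/

namespace RandicCyclic

/-! ### Double counting over ordered adjacent pairs, and the penalty form of the Randić index. -/

section AdjSum

variable {V : Type*} [Fintype V]

open Classical in
/-- The sum of `g (deg u) (deg v)` over all ordered pairs `(u, v)` of adjacent vertices. -/
noncomputable def adjSum {R : Type*} [AddCommMonoid R] (G : SimpleGraph V) (g : ℕ → ℕ → R) : R :=
  ∑ u : V, ∑ v : V, if G.Adj u v then g (G.degree u) (G.degree v) else 0

open Classical in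
theorem two_mul_sum_edgeFinset {R : Type*} [NonAssocSemiring R] (G : SimpleGraph V)
    (F : Sym2 V → R) :
    2 * ∑ e ∈ G.edgeFinset, F e = ∑ u : V, ∑ v : V, if G.Adj u v then F s(u, v) else 0 := by
  rw [← Finset.sum_product', Finset.univ_product_univ, ← Finset.sum_filter]
  rw [← Finset.sum_fiberwise_of_maps_to (t := G.edgeFinset)
    (g := fun p : V × V => s(p.1, p.2)), Finset.mul_sum]
  · refine Finset.sum_congr rfl fun e he => ?_
    induction e using Sym2.ind with
    | _ a b =>
      have hab : G.Adj a b := by simpa using he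
      have hset : (Finset.univ.filter fun p : V × V => G.Adj p.1 p.2).filter
          (fun p => s(p.1, p.2) = s(a, b)) = {(a, b), (b, a)} := by
        ext ⟨u, v⟩
        simp only [Finset.mem_filter, Finset.mem_univ, true_and, Finset.mem_insert,
          Finset.mem_singleton, Prod.mk.injEq, Sym2.eq_iff]
        constructor
        · exact fun h => h.2
        · rintro (⟨rfl, rfl⟩ | ⟨rfl, rfl⟩)
          · exact ⟨hab, by simp⟩
          · exact ⟨hab.symm, by simp⟩
      rw [hset, Finset.sum_pair (by simp [hab.ne]), Sym2.eq_swap (a := b), two_mul]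
  · intro p hp
    simpa using hp

theorem adjSum_swap {R : Type*} [AddCommMonoid R] (G : SimpleGraph V) (g : ℕ → ℕ → R) :
    adjSum G (fun i j => g j i) = adjSum G g := by
  unfold adjSum
  rw [Finset.sum_comm]
  refine Finset.sum_congr rfl fun u _ => Finset.sum_congr rfl fun v _ => ?_
  by_cases h : G.Adj u v
  · rw [if_pos h, if_pos h.symm]
  · rw [if_neg h, if_neg fun h' => h h'.symm]

theorem adjSum_add {R : Type*} [AddCommMonoid R] (G : SimpleGraph V) (g h : ℕ → ℕ → R) :
    adjSum G (fun i j => g i j + h i j) = adjSum G g + adjSum G h := by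
  unfold adjSum
  simp only [← Finset.sum_add_distrib]
  refine Finset.sum_congr rfl fun u _ => Finset.sum_congr rfl fun v _ => ?_
  split_ifs <;> simp

theorem adjSum_const_mul {R : Type*} [NonAssocSemiring R] (G : SimpleGraph V) (c : R)
    (g : ℕ → ℕ → R) : adjSum G (fun i j => c * g i j) = c * adjSum G g := by
  unfold adjSum
  simp only [Finset.mul_sum, mul_ite, mul_zero]

open Classical in
theorem adjSum_congr {R : Type*} [AddCommMonoid R] (G : SimpleGraph V) {g h : ℕ → ℕ → R}
    (H : ∀ u v, G.Adj u v → g (G.degree u) (G.degree v) = h (G.degree u) (G.degree v)) :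
    adjSum G g = adjSum G h := by
  unfold adjSum
  refine Finset.sum_congr rfl fun u _ => Finset.sum_congr rfl fun v _ => ?_
  split_ifs with huv
  · exact H u v huv
  · rfl

open Classical in
theorem adjSum_mono {R : Type*} [AddCommMonoid R] [PartialOrder R] [IsOrderedAddMonoid R]
    (G : SimpleGraph V) {g h : ℕ → ℕ → R}
    (H : ∀ u v, G.Adj u v → g (G.degree u) (G.degree v) ≤ h (G.degree u) (G.degree v)) :
    adjSum G g ≤ adjSum G h := by
  unfold adjSum
  refine Finset.sum_le_sum fun u _ => Finset.sum_le_sum fun v _ => ?_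
  split_ifs with huv
  · exact H u v huv
  · rfl

open Classical in
theorem adjSum_pos (G : SimpleGraph V) {g : ℕ → ℕ → ℕ} {u v : V} (huv : G.Adj u v)
    (h : 0 < g (G.degree u) (G.degree v)) : 0 < adjSum G g := by
  unfold adjSum
  refine Finset.sum_pos' (fun _ _ => Nat.zero_le _) ⟨u, Finset.mem_univ _, ?_⟩
  exact Finset.sum_pos' (fun _ _ => Nat.zero_le _) ⟨v, Finset.mem_univ _, by simpa [huv] using h⟩

theorem adjSum_natCast (G : SimpleGraph V) (g : ℕ → ℕ → ℕ) :
    ((adjSum G g : ℕ) : ℝ) = adjSum G (fun i j => (g i j : ℝ)) := by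
  unfold adjSum
  push_cast
  rfl

open Classical in
theorem adjSum_fst {R : Type*} [NonAssocSemiring R] (G : SimpleGraph V) (h : ℕ → R) :
    adjSum G (fun i _ => h i) = ∑ u : V, (G.degree u : R) * h (G.degree u) := by
  unfold adjSum
  refine Finset.sum_congr rfl fun u _ => ?_
  rw [← Finset.sum_filter, Finset.sum_const, nsmul_eq_mul, ← G.neighborFinset_eq_filter,
    G.card_neighborFinset_eq_degree]

open Classical in
theorem degCount_eq (G : SimpleGraph V) (i : ℕ) :
    degCount G i = ∑ u : V, if G.degree u = i then 1 else 0 := by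
  unfold degCount
  rw [Set.ncard_eq_toFinset_card', Finset.sum_boole]
  simp

theorem adjSum_fst_eq (G : SimpleGraph V) (k : ℕ) :
    adjSum G (fun i _ => if i = k then 1 else 0) = k * degCount G k := by
  rw [adjSum_fst, degCount_eq, Finset.mul_sum]
  refine Finset.sum_congr rfl fun u _ => ?_
  split_ifs with h <;> simp [h]

/-- The indicator is a disjunction, not a sum of two indicators, so that the formula also holds for
`i = j`. -/
theorem two_mul_edgeCount (G : SimpleGraph V) (i j : ℕ) :
    2 * edgeCount G i j =
      adjSum G (fun k l => if (k = i ∧ l = j) ∨ (l = i ∧ k = j) then 1 else 0) := by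
  classical
  have h := two_mul_sum_edgeFinset G
    (fun e => if ∃ u v : V, e = s(u, v) ∧ G.degree u = i ∧ G.degree v = j then 1 else 0)
  have h2 : edgeCount G i j = ∑ e ∈ G.edgeFinset,
      if ∃ u v : V, e = s(u, v) ∧ G.degree u = i ∧ G.degree v = j then 1 else 0 := by
    rw [Finset.sum_boole]
    unfold edgeCount
    rw [Nat.cast_id, ← Set.ncard_coe_finset]
    congr 1
    ext e
    simp only [Set.mem_ofPred_eq, Finset.coe_filter, SimpleGraph.mem_edgeFinset]
  rw [h2, h]
  unfold adjSum
  refine Finset.sum_congr rfl fun u _ => Finset.sum_congr rfl fun v _ => ?_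
  have : (∃ a b : V, s(u, v) = s(a, b) ∧ G.degree a = i ∧ G.degree b = j) ↔
      ((G.degree u = i ∧ G.degree v = j) ∨ (G.degree v = i ∧ G.degree u = j)) := by
    constructor
    · rintro ⟨a, b, hab, h1, h2⟩
      rcases Sym2.eq_iff.1 hab with ⟨rfl, rfl⟩ | ⟨rfl, rfl⟩
      · exact Or.inl ⟨h1, h2⟩
      · exact Or.inr ⟨h1, h2⟩
    · rintro (⟨h1, h2⟩ | ⟨h1, h2⟩)
      · exact ⟨u, v, rfl, h1, h2⟩
      · exact ⟨v, u, Sym2.eq_swap, h1, h2⟩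
  simp only [this]

/-- The number of ordered pairs of adjacent vertices of degrees `i` and `j`. -/
noncomputable def pairCount (G : SimpleGraph V) (i j : ℕ) : ℕ :=
  adjSum G (fun k l => if k = i ∧ l = j then 1 else 0)

theorem pairCount_comm (G : SimpleGraph V) (i j : ℕ) : pairCount G i j = pairCount G j i := by
  unfold pairCount
  rw [← adjSum_swap]
  simp only [and_comm]

theorem edgeCount_of_ne (G : SimpleGraph V) {i j : ℕ} (h : i ≠ j) :
    edgeCount G i j = pairCount G i j := by
  have h1 := two_mul_edgeCount G i j
  have h2 : adjSum G (fun k l => if (k = i ∧ l = j) ∨ (l = i ∧ k = j) then 1 else 0) =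
      pairCount G i j + pairCount G j i := by
    unfold pairCount
    rw [← adjSum_add]
    refine adjSum_congr G fun u v _ => ?_
    split_ifs <;> omega
  rw [h2, pairCount_comm G j i] at h1
  omega

theorem two_mul_edgeCount_self (G : SimpleGraph V) (i : ℕ) :
    2 * edgeCount G i i = pairCount G i i := by
  rw [two_mul_edgeCount]
  unfold pairCount
  refine adjSum_congr G fun u v _ => ?_
  split_ifs <;> omega

theorem two_mul_ncard_edgeSet (G : SimpleGraph V) :
    2 * G.edgeSet.ncard = adjSum G (fun _ _ => 1) := by
  classical
  have h := two_mul_sum_edgeFinset G (fun _ => 1)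
  rw [Finset.sum_const, smul_eq_mul, mul_one] at h
  unfold adjSum
  rw [← SimpleGraph.coe_edgeFinset, Set.ncard_coe_finset, h]

/-- Twice the sum over the edges `uv` of `(1 / √(deg u) - 1 / √(deg v)) ^ 2`. -/
noncomputable def energy (G : SimpleGraph V) : ℝ :=
  adjSum G (fun i j => (1 / √(i : ℝ) - 1 / √(j : ℝ)) ^ 2)

open Classical in
-- Expand the square in `energy`: the cross term is the Randić summand, and each pure term `1 / deg`
-- sums to the number of vertices. An isolated vertex would contribute 0 instead of 1.
theorem four_mul_randicIndex (G : SimpleGraph V) (h : ∀ v, 0 < G.degree v) :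
    4 * randicIndex G = 2 * Fintype.card V - energy G := by
  have h1 : 2 * randicIndex G = adjSum G (fun i j => 1 / √((i : ℝ) * j)) := by
    unfold randicIndex
    rw [two_mul_sum_edgeFinset]
    rfl
  have h2 : adjSum G (fun i _ => 1 / (i : ℝ)) = Fintype.card V := by
    rw [adjSum_fst]
    have : ∀ u : V, (G.degree u : ℝ) * (1 / (G.degree u : ℝ)) = 1 := fun u =>
      mul_one_div_cancel (by exact_mod_cast (h u).ne')
    rw [Finset.sum_congr rfl fun u _ => this u]
    simp
  have h3 : energy G + 2 * adjSum G (fun i j => 1 / √((i : ℝ) * j)) =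
      adjSum G (fun i _ => 1 / (i : ℝ)) + adjSum G (fun _ j => 1 / (j : ℝ)) := by
    unfold energy
    rw [← adjSum_const_mul, ← adjSum_add, ← adjSum_add]
    refine adjSum_congr G fun u v _ => ?_
    have hu : (0 : ℝ) ≤ G.degree u := Nat.cast_nonneg _
    have hv : (0 : ℝ) ≤ G.degree v := Nat.cast_nonneg _
    rw [Real.sqrt_mul hu, sub_sq, div_pow, div_pow, Real.sq_sqrt hu, Real.sq_sqrt hv]
    ring
  rw [adjSum_swap G (fun i _ => 1 / (i : ℝ)), h2] at h3
  linarith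

end AdjSum



/-! ### Numerical comparison of edge penalties. -/

section Numerics

/-- The contribution `(1 / √i - 1 / √j) ^ 2` of an edge joining vertices of degrees `i`, `j`. -/
noncomputable def edgeWeight (i j : ℕ) : ℝ := (1 / √(i : ℝ) - 1 / √(j : ℝ)) ^ 2

theorem edgeWeight_nonneg (i j : ℕ) : 0 ≤ edgeWeight i j := sq_nonneg _

theorem edgeWeight_self (i : ℕ) : edgeWeight i i = 0 := by simp [edgeWeight]

theorem edgeWeight_comm (i j : ℕ) : edgeWeight i j = edgeWeight j i := by
  unfold edgeWeight; ring

theorem edgeWeight_mono {i j k : ℕ} (hi : 0 < i) (hij : i ≤ j) (hjk : j ≤ k) :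
    edgeWeight i j ≤ edgeWeight i k := by
  have hi' : (0 : ℝ) < √(i : ℝ) := Real.sqrt_pos.2 (by exact_mod_cast hi)
  have hj' : (0 : ℝ) < √(j : ℝ) := Real.sqrt_pos.2 (by exact_mod_cast hi.trans_le hij)
  have h1 : 1 / √(j : ℝ) ≤ 1 / √(i : ℝ) :=
    one_div_le_one_div_of_le hi' (Real.sqrt_le_sqrt (by exact_mod_cast hij))
  have h2 : 1 / √(k : ℝ) ≤ 1 / √(j : ℝ) :=
    one_div_le_one_div_of_le hj' (Real.sqrt_le_sqrt (by exact_mod_cast hjk))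
  unfold edgeWeight
  exact pow_le_pow_left₀ (by linarith) (by linarith) 2

theorem one_div_sqrt_bounds {x a b : ℝ} (hx : 0 < x) (hb : 0 ≤ b)
    (h1 : a ^ 2 * x < 1) (h2 : 1 < b ^ 2 * x) : a < 1 / √x ∧ 1 / √x < b := by
  have hs : (1 / √x) ^ 2 * x = 1 := by
    rw [div_pow, Real.sq_sqrt hx.le]; field_simp
  have h0 : 0 ≤ 1 / √x := by positivity
  constructor
  · exact lt_of_pow_lt_pow_left₀ 2 h0 (lt_of_mul_lt_mul_right (by rw [hs]; exact h1) hx.le)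
  · exact lt_of_pow_lt_pow_left₀ 2 hb (lt_of_mul_lt_mul_right (by rw [hs]; exact h2) hx.le)

/-- Beyond positivity, each inequality excludes one competitor to the second-best penalty `2 w(2,3)
+ 4 w(3,4)`: four edges leaving degree 2, an edge from degree 2 to degree at least 4, and a leaf. -/
theorem edgeWeight_estimates :
    0 < edgeWeight 3 4 ∧ 2 * edgeWeight 3 4 < edgeWeight 2 3 ∧
    edgeWeight 2 3 + 4 * edgeWeight 3 4 < edgeWeight 2 4 ∧
    2 * edgeWeight 2 3 + 4 * edgeWeight 3 4 < edgeWeight 1 2 := by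
  have h4 : √(4 : ℝ) = 2 := by
    rw [show (4 : ℝ) = 2 ^ 2 by norm_num]; exact Real.sqrt_sq (by norm_num)
  obtain ⟨hx1, hx2⟩ := one_div_sqrt_bounds (x := 2) (a := 0.7071) (b := 0.7072)
    (by norm_num) (by norm_num) (by norm_num) (by norm_num)
  obtain ⟨hy1, hy2⟩ := one_div_sqrt_bounds (x := 3) (a := 0.5773) (b := 0.5774)
    (by norm_num) (by norm_num) (by norm_num) (by norm_num)
  unfold edgeWeight
  push_cast
  rw [h4, Real.sqrt_one]
  generalize 1 / √(2 : ℝ) = x at *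
  generalize 1 / √(3 : ℝ) = y at *
  have ha1 : (0.1297 : ℝ) ^ 2 ≤ (x - y) ^ 2 :=
    pow_le_pow_left₀ (by norm_num) (by linarith) 2
  have ha2 : (x - y) ^ 2 ≤ (0.1299 : ℝ) ^ 2 :=
    pow_le_pow_left₀ (by linarith) (by linarith) 2
  have hb1 : (0.0773 : ℝ) ^ 2 ≤ (y - 1 / 2) ^ 2 :=
    pow_le_pow_left₀ (by norm_num) (by linarith) 2
  have hb2 : (y - 1 / 2) ^ 2 ≤ (0.0774 : ℝ) ^ 2 :=
    pow_le_pow_left₀ (by linarith) (by linarith) 2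
  have hc : (0.2071 : ℝ) ^ 2 ≤ (x - 1 / 2) ^ 2 :=
    pow_le_pow_left₀ (by norm_num) (by linarith) 2
  have hd : (0.2928 : ℝ) ^ 2 ≤ (1 / 1 - x) ^ 2 :=
    pow_le_pow_left₀ (by norm_num) (by linarith) 2
  norm_num at *
  refine ⟨?_, ?_, ?_, ?_⟩ <;> linarith

end Numerics

/-! ### Lower bounds for the energy by counting edges between degree levels. -/

section Bounds

variable {V : Type*} [Fintype V]

theorem energy_eq (G : SimpleGraph V) : energy G = adjSum G edgeWeight := rfl

/-- The number of ordered adjacent pairs `(u, v)` with `deg u = i` and `deg v ≥ j`. -/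
noncomputable def upCount (G : SimpleGraph V) (i j : ℕ) : ℕ :=
  adjSum G (fun k l => if k = i ∧ j ≤ l then 1 else 0)

theorem adjSum_mul_indicator (G : SimpleGraph V) (c : ℝ) (i j : ℕ) :
    adjSum G (fun k l => c * ((if k = i ∧ j ≤ l then 1 else 0 : ℕ) : ℝ)) = c * upCount G i j := by
  rw [adjSum_const_mul, upCount, adjSum_natCast]

open Classical in
/-- A one-sided bound on the contributions of the edges bounds the energy. -/
theorem two_mul_adjSum_le_energy (G : SimpleGraph V) (t : ℕ → ℕ → ℝ)
    (H : ∀ u v, G.Adj u v → t (G.degree u) (G.degree v) + t (G.degree v) (G.degree u) ≤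
      edgeWeight (G.degree u) (G.degree v)) : 2 * adjSum G t ≤ energy G := by
  have h1 := adjSum_mono G (g := fun i j => t i j + t j i) (h := edgeWeight) H
  rw [adjSum_add, adjSum_swap G t] at h1
  rw [energy_eq]
  linarith

open Classical in
theorem upCount_one_le_energy (G : SimpleGraph V) :
    2 * (edgeWeight 1 2 * upCount G 1 2) ≤ energy G := by
  rw [← adjSum_mul_indicator]
  refine two_mul_adjSum_le_energy G _ fun u v _ => ?_
  generalize G.degree u = i
  generalize G.degree v = j
  by_cases h1 : i = 1 ∧ 2 ≤ j
  · obtain ⟨rfl, hj⟩ := h1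
    have := edgeWeight_mono one_pos one_le_two hj
    have h' : ¬ (j = 1 ∧ 2 ≤ 1) := by omega
    simp [hj, this]
  · by_cases h2 : j = 1 ∧ 2 ≤ i
    · obtain ⟨rfl, hj⟩ := h2
      have := edgeWeight_mono one_pos one_le_two hj
      rw [edgeWeight_comm 1 i] at this
      simp [hj, this]
    · simp [h1, h2, edgeWeight_nonneg]

open Classical in
-- An edge from degree 2 to degree at least 4 is already charged `w(2,3)` by the first count, so the
-- last term charges only the difference. Monotonicity reduces larger degrees to degree 4.
theorem upCount_le_energy (G : SimpleGraph V) (h2 : ∀ v, 2 ≤ G.degree v) :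
    2 * (edgeWeight 2 3 * upCount G 2 3 + edgeWeight 3 4 * upCount G 3 4 +
      (edgeWeight 2 4 - edgeWeight 2 3) * upCount G 2 4) ≤ energy G := by
  rw [← adjSum_mul_indicator, ← adjSum_mul_indicator, ← adjSum_mul_indicator, ← adjSum_add,
    ← adjSum_add]
  refine two_mul_adjSum_le_energy G _ fun u v _ => ?_
  have hi := h2 u
  have hj := h2 v
  generalize G.degree u = i at *
  generalize G.degree v = j at *
  wlog hij : i ≤ j generalizing i j
  · rw [add_comm, edgeWeight_comm i j]
    exact this j hj i hi (by omega)
  have hw := edgeWeight_nonneg i j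
  have c1 : ¬ (j = 2 ∧ 3 ≤ i) := by omega
  have c2 : ¬ (j = 2 ∧ 4 ≤ i) := by omega
  have c3 : ¬ (j = 3 ∧ 4 ≤ i) := by omega
  simp only [c1, c2, c3, if_false]
  obtain rfl | rfl | hi4 : i = 2 ∨ i = 3 ∨ 4 ≤ i := by omega
  · obtain rfl | rfl | hj4 : j = 2 ∨ j = 3 ∨ 4 ≤ j := by omega
    · norm_num [edgeWeight_self]
    · norm_num
    · have h3 : 3 ≤ j := by omega
      have := edgeWeight_mono (i := 2) (by norm_num) (by norm_num) hj4
      norm_num [hj4, h3]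
      linarith
  · by_cases hj4 : 4 ≤ j
    · have := edgeWeight_mono (i := 3) (by norm_num) (by norm_num) hj4
      norm_num [hj4]
      linarith
    · norm_num [hj4]
      linarith
  · have d1 : i ≠ 2 := by omega
    have d2 : i ≠ 3 := by omega
    simp only [d1, d2, false_and, if_false]
    norm_num
    linarith

theorem exists_adj_of_connected {V : Type*} {G : SimpleGraph V} (hG : G.Connected)
    {p : V → Prop} {a b : V} (ha : p a) (hb : ¬ p b) : ∃ u v, G.Adj u v ∧ p u ∧ ¬ p v := by
  obtain ⟨w⟩ := hG.preconnected a b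
  obtain ⟨d, -, h1, h2⟩ := w.exists_boundary_dart {x | p x} ha hb
  exact ⟨d.fst, d.snd, d.adj, h1, h2⟩

end Bounds



/-! ### The two optimal degree patterns and the counts they force. -/

section Shapes

variable {V : Type*} [Fintype V]

open Classical in
/-- All degrees are `2` or `3`, and exactly two edges join vertices of different degrees. -/
def IsBicubicLike (G : SimpleGraph V) : Prop :=
  (∀ v, G.degree v = 2 ∨ G.degree v = 3) ∧ pairCount G 2 3 = 2

open Classical in
/-- The degrees are `2`, `3` and a single `4`, exactly two edges join a vertex of degree `2` to one
of degree `3`, and none joins a vertex of degree `2` to the one of degree `4`. -/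
def HasQuarticVertex (G : SimpleGraph V) : Prop :=
  (∀ v, G.degree v = 2 ∨ G.degree v = 3 ∨ G.degree v = 4) ∧ degCount G 4 = 1 ∧
    pairCount G 2 3 = 2 ∧ pairCount G 2 4 = 0

open Classical in
theorem sum_degrees_of_cyclic (G : SimpleGraph V) {c : ℕ}
    (hG : G.edgeSet.ncard + 1 = Fintype.card V + c) :
    ∑ v, G.degree v + 2 = 2 * Fintype.card V + 2 * c := by
  have h := two_mul_ncard_edgeSet G
  rw [adjSum_fst] at h
  simp only [mul_one, Nat.cast_id] at h
  omega

open Classical in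
theorem card_eq_of_degrees (G : SimpleGraph V)
    (h : ∀ v, G.degree v = 2 ∨ G.degree v = 3 ∨ G.degree v = 4) :
    Fintype.card V = degCount G 2 + degCount G 3 + degCount G 4 ∧
    ∑ v, G.degree v = 2 * degCount G 2 + 3 * degCount G 3 + 4 * degCount G 4 := by
  simp only [degCount_eq, Finset.mul_sum, ← Finset.sum_add_distrib]
  rw [Fintype.card_eq_sum_ones]
  constructor <;> refine Finset.sum_congr rfl fun v _ => ?_ <;>
    rcases h v with h | h | h <;> simp [h]

open Classical in
theorem degCount_mul_eq_of_degrees (G : SimpleGraph V)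
    (h : ∀ v, G.degree v = 2 ∨ G.degree v = 3 ∨ G.degree v = 4) (k : ℕ) :
    k * degCount G k = pairCount G k 2 + pairCount G k 3 + pairCount G k 4 := by
  rw [← adjSum_fst_eq]
  unfold pairCount
  rw [← adjSum_add, ← adjSum_add]
  refine adjSum_congr G fun u v _ => ?_
  rcases h v with h | h | h <;> simp [h]

open Classical in
-- There are no loops, so adjacent pairs inside a set of `x` vertices lie off its diagonal.
theorem adjSum_indicator_le (G : SimpleGraph V) (p : ℕ → Prop) [DecidablePred p] (x : ℕ)
    (hx : ∑ v, (if p (G.degree v) then 1 else 0) = x) :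
    adjSum G (fun k l => if p k ∧ p l then 1 else 0) ≤ x * x - x := by
  rw [Finset.sum_boole, Nat.cast_id] at hx
  rw [← hx, ← Finset.offDiag_card]
  unfold adjSum
  rw [← Finset.sum_product', Finset.univ_product_univ]
  calc _ ≤ ∑ e : V × V,
        if e ∈ (Finset.univ.filter fun v => p (G.degree v)).offDiag then 1 else 0 := by
        refine Finset.sum_le_sum fun e _ => ?_
        by_cases h : G.Adj e.1 e.2
        · simp [h, h.ne]
        · simp [h]
    _ = _ := by rw [Finset.sum_boole, Finset.filter_univ_mem, Nat.cast_id]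

theorem pairCount_self_eq_zero (G : SimpleGraph V) {i : ℕ} (h : degCount G i ≤ 1) :
    pairCount G i i = 0 := by
  classical
  have := adjSum_indicator_le G (fun k => k = i) (degCount G i) (degCount_eq G i).symm
  unfold pairCount
  have h2 : degCount G i * degCount G i - degCount G i = 0 := by
    interval_cases degCount G i <;> rfl
  rw [h2] at this
  exact Nat.le_zero.1 this

theorem adjSum_mul_pairCount (G : SimpleGraph V) (c : ℝ) (i j : ℕ) :
    adjSum G (fun k l => c * ((if k = i ∧ l = j then 1 else 0 : ℕ) : ℝ)) = c * pairCount G i j := by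
  rw [adjSum_const_mul, pairCount, adjSum_natCast]

open Classical in
theorem energy_of_degrees (G : SimpleGraph V)
    (h : ∀ v, G.degree v = 2 ∨ G.degree v = 3 ∨ G.degree v = 4) :
    energy G = 2 * (edgeWeight 2 3 * pairCount G 2 3 + edgeWeight 3 4 * pairCount G 3 4 +
      edgeWeight 2 4 * pairCount G 2 4) := by
  rw [← adjSum_mul_pairCount, ← adjSum_mul_pairCount, ← adjSum_mul_pairCount, ← adjSum_add,
    ← adjSum_add, two_mul]
  nth_rewrite 1 [← adjSum_swap]
  rw [← adjSum_add, energy_eq]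
  refine adjSum_congr G fun u v _ => ?_
  rcases h u with hu | hu | hu <;> rcases h v with hv | hv | hv <;>
    simp [hu, hv, edgeWeight_self, edgeWeight_comm 4 2, edgeWeight_comm 4 3, edgeWeight_comm 3 2]

namespace IsBicubicLike

/-- A linear system: the vertex count and the degree sum determine `n₂` and `n₃`; counting
neighbours of the degree-2 and degree-3 vertices then determines the edge counts. -/
theorem counts {G : SimpleGraph V} (h : IsBicubicLike G) {c : ℕ}
    (hG : G.edgeSet.ncard + 1 = Fintype.card V + c) :
    degCount G 3 + 2 = 2 * c ∧ degCount G 2 + 2 * c = Fintype.card V + 2 ∧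
      edgeCount G 3 3 + 4 = 3 * c ∧ edgeCount G 2 3 = 2 ∧
      edgeCount G 2 2 + 2 * c = Fintype.card V + 1 ∧ energy G = 4 * edgeWeight 2 3 := by
  classical
  obtain ⟨h1, h2⟩ := h
  have hd : ∀ v, G.degree v = 2 ∨ G.degree v = 3 ∨ G.degree v = 4 := fun v => by
    rcases h1 v with h | h <;> simp [h]
  have h4 : degCount G 4 = 0 := by
    rw [degCount_eq]
    refine Finset.sum_eq_zero fun v _ => ?_
    rcases h1 v with h | h <;> simp [h]
  have e0 := sum_degrees_of_cyclic G hG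
  obtain ⟨e1, e2⟩ := card_eq_of_degrees G hd
  have f2 := degCount_mul_eq_of_degrees G hd 2
  have f3 := degCount_mul_eq_of_degrees G hd 3
  have f4 := degCount_mul_eq_of_degrees G hd 4
  have s2 := two_mul_edgeCount_self G 2
  have s3 := two_mul_edgeCount_self G 3
  have s23 := edgeCount_of_ne G (show 2 ≠ 3 by norm_num)
  have c1 := pairCount_comm G 2 3
  have c2 := pairCount_comm G 2 4
  have c3 := pairCount_comm G 3 4
  have z1 : pairCount G 2 4 = 0 := by omega
  have z2 : pairCount G 3 4 = 0 := by omega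
  refine ⟨by omega, by omega, by omega, by omega, by omega, ?_⟩
  rw [energy_of_degrees G hd, h2, z1, z2]
  push_cast
  ring

end IsBicubicLike

/-- Each vertex contributes at most 1 to `n₂ + n₃`, so a total equal to the order forces every
contribution to be 1. -/
theorem isBicubicLike_of_counts {G : SimpleGraph V}
    (h1 : degCount G 2 + degCount G 3 = Fintype.card V) (h2 : edgeCount G 2 3 = 2) :
    IsBicubicLike G := by
  classical
  rw [edgeCount_of_ne G (by norm_num)] at h2
  refine ⟨?_, h2⟩
  rw [degCount_eq, degCount_eq, ← Finset.sum_add_distrib, Fintype.card_eq_sum_ones,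
    Finset.sum_eq_sum_iff_of_le (fun v _ => by split_ifs <;> omega)] at h1
  intro v
  have := h1 v (Finset.mem_univ v)
  split_ifs at this <;> omega

namespace HasQuarticVertex

theorem counts {G : SimpleGraph V} (h : HasQuarticVertex G) {c : ℕ}
    (hG : G.edgeSet.ncard + 1 = Fintype.card V + c) :
    degCount G 1 = 0 ∧ degCount G 3 + 4 = 2 * c ∧ degCount G 2 + 2 * c = Fintype.card V + 3 ∧
      edgeCount G 4 3 = 4 ∧ edgeCount G 3 3 + 9 = 3 * c ∧ edgeCount G 2 3 = 2 ∧
      edgeCount G 2 2 + 2 * c = Fintype.card V + 2 ∧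
      energy G = 4 * edgeWeight 2 3 + 8 * edgeWeight 3 4 := by
  classical
  obtain ⟨hd, h4, h2, z1⟩ := h
  have e0 := sum_degrees_of_cyclic G hG
  obtain ⟨e1, e2⟩ := card_eq_of_degrees G hd
  have f2 := degCount_mul_eq_of_degrees G hd 2
  have f3 := degCount_mul_eq_of_degrees G hd 3
  have f4 := degCount_mul_eq_of_degrees G hd 4
  have s2 := two_mul_edgeCount_self G 2
  have s3 := two_mul_edgeCount_self G 3
  have s23 := edgeCount_of_ne G (show 2 ≠ 3 by norm_num)
  have s43 := edgeCount_of_ne G (show 4 ≠ 3 by norm_num)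
  have c1 := pairCount_comm G 2 3
  have c2 := pairCount_comm G 2 4
  have c3 := pairCount_comm G 3 4
  have z2 := pairCount_self_eq_zero G h4.le
  -- The single vertex of degree 4 has no neighbour of degree 2 or 4, so its four neighbours all
  -- have degree 3.
  have z3 : pairCount G 3 4 = 4 := by omega
  refine ⟨?_, by omega, by omega, by omega, by omega, by omega, by omega, ?_⟩
  · rw [degCount_eq]
    refine Finset.sum_eq_zero fun v _ => ?_
    rcases hd v with h | h | h <;> simp [h]
  · rw [energy_of_degrees G hd, h2, z1, z3]
    push_cast
    ring

end HasQuarticVertex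

theorem hasQuarticVertex_of_counts {G : SimpleGraph V}
    (h1 : degCount G 2 + degCount G 3 + degCount G 4 = Fintype.card V) (h4 : degCount G 4 = 1)
    (h2 : edgeCount G 2 3 = 2) (h3 : edgeCount G 4 3 = 4) : HasQuarticVertex G := by
  classical
  have hd : ∀ v, G.degree v = 2 ∨ G.degree v = 3 ∨ G.degree v = 4 := by
    rw [degCount_eq, degCount_eq, degCount_eq, ← Finset.sum_add_distrib, ← Finset.sum_add_distrib,
      Fintype.card_eq_sum_ones,
      Finset.sum_eq_sum_iff_of_le (fun v _ => by split_ifs <;> omega)] at h1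
    intro v
    have := h1 v (Finset.mem_univ v)
    split_ifs at this <;> omega
  have f4 := degCount_mul_eq_of_degrees G hd 4
  have c2 := pairCount_comm G 2 4
  rw [edgeCount_of_ne G (by norm_num)] at h2 h3
  exact ⟨hd, h4, h2, by omega⟩

end Shapes



/-! ### Classification of graphs by energy. -/

section Trichotomy

variable {V : Type*} [Fintype V]

open Classical in
theorem even_upCount_two (G : SimpleGraph V) (h2 : ∀ v, 2 ≤ G.degree v) :
    Even (upCount G 2 3) := by
  have h : 2 * degCount G 2 = pairCount G 2 2 + upCount G 2 3 := by
    rw [← adjSum_fst_eq]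
    unfold pairCount upCount
    rw [← adjSum_add]
    refine adjSum_congr G fun u v _ => ?_
    have := h2 v
    split_ifs <;> omega
  have := two_mul_edgeCount_self G 2
  rw [Nat.even_iff]
  omega

open Classical in
theorem upCount_eq_pairCount_add (G : SimpleGraph V) (i j : ℕ) :
    upCount G i j = pairCount G i j + upCount G i (j + 1) := by
  unfold pairCount upCount
  rw [← adjSum_add]
  refine adjSum_congr G fun u v _ => ?_
  split_ifs <;> omega

open Classical in
/-- Degrees at least `2`: the edges leaving the set of the `x` vertices of degree at least `4`. -/
theorem sum_degrees_le (G : SimpleGraph V) (h2 : ∀ v, 2 ≤ G.degree v) {x : ℕ}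
    (hx : ∑ v, (if 4 ≤ G.degree v then 1 else 0) = x) :
    ∑ v, (if 4 ≤ G.degree v then G.degree v else 0) ≤
      (x * x - x) + upCount G 3 4 + upCount G 2 4 := by
  have h := adjSum_indicator_le G (fun k => 4 ≤ k) x hx
  have h' : adjSum G (fun k _ => if 4 ≤ k then 1 else 0) =
      adjSum G (fun k l => if 4 ≤ k ∧ 4 ≤ l then 1 else 0) + upCount G 3 4 + upCount G 2 4 := by
    unfold upCount
    -- `upCount` lists the low-degree end first; reverse the pairs so that the high-degree end
    -- leads.
    rw [← adjSum_swap G (fun k l => if k = 3 ∧ 4 ≤ l then 1 else 0),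
      ← adjSum_swap G (fun k l => if k = 2 ∧ 4 ≤ l then 1 else 0), ← adjSum_add, ← adjSum_add]
    refine adjSum_congr G fun u v _ => ?_
    have := h2 v
    split_ifs <;> omega
  rw [adjSum_fst] at h'
  have h'' : ∑ v, (if 4 ≤ G.degree v then G.degree v else 0) =
      ∑ v, (G.degree v : ℕ) * (if 4 ≤ G.degree v then 1 else 0) :=
    Finset.sum_congr rfl fun v _ => by simp
  simp only [Nat.cast_id] at h'
  omega

open Classical in
theorem four_mul_le_sum (G : SimpleGraph V) {x : ℕ}
    (hx : ∑ v, (if 4 ≤ G.degree v then 1 else 0) = x) :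
    4 * x ≤ ∑ v, (if 4 ≤ G.degree v then G.degree v else 0) := by
  rw [← hx, Finset.mul_sum]
  refine Finset.sum_le_sum fun v _ => ?_
  split_ifs <;> omega

open Classical in
/-- In a graph of minimum degree at least `2` with a vertex of degree `2`, all of whose vertices of
degree at least `4` are adjacent to vertices of degree at least `3` only, at least four edges join
a vertex of degree `3` to one of greater degree. -/
theorem four_le_upCount (G : SimpleGraph V) {c : ℕ} (hc : c ≤ 6)
    (hG : G.edgeSet.ncard + 1 = Fintype.card V + c) (h2 : ∀ v, 2 ≤ G.degree v)
    (h23 : pairCount G 2 3 = 2) (h24 : upCount G 2 4 = 0) (h4 : ∃ v, 4 ≤ G.degree v) :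
    4 ≤ upCount G 3 4 ∧ (c ≤ 5 → upCount G 3 4 = 4 → HasQuarticVertex G) := by
  obtain ⟨x, hx⟩ : ∃ x, ∑ v, (if 4 ≤ G.degree v then 1 else 0) = x := ⟨_, rfl⟩
  have hle := sum_degrees_le G h2 hx
  have hge := four_mul_le_sum G hx
  have hx0 : 1 ≤ x := by
    obtain ⟨v, hv⟩ := h4
    rw [← hx]
    exact Finset.sum_pos' (fun _ _ => Nat.zero_le _) ⟨v, Finset.mem_univ _, by simp [hv]⟩
  have hs := sum_degrees_of_cyclic G hG
  have hs' : 2 * Fintype.card V + degCount G 3 + 2 * x ≤ ∑ v, G.degree v := by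
    rw [← hx, Fintype.card_eq_sum_ones, degCount_eq, Finset.mul_sum, Finset.mul_sum,
      ← Finset.sum_add_distrib, ← Finset.sum_add_distrib]
    refine Finset.sum_le_sum fun v _ => ?_
    have := h2 v
    split_ifs <;> omega
  -- Together with `h23` this yields a vertex of degree 3, whose share of the budget `n₃ + 2x ≤ 2c -
  -- 2` sharpens the bound on `x`: at most 4 for `c = 6`, at most 3 for `c ≤ 5`.
  have h3 : pairCount G 2 3 ≤ 3 * degCount G 3 := by
    rw [pairCount_comm, ← adjSum_fst_eq]
    unfold pairCount
    refine adjSum_mono G fun u v _ => ?_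
    split_ifs <;> omega
  have hx4 : x ≤ 4 := by omega
  refine ⟨by interval_cases x <;> omega, fun hc5 h34 => ?_⟩
  -- For `x = 2` or `3` at least `x(5 - x) = 6` edges would leave the set, against the 4 in `h34`.
  have hx1 : x = 1 := by
    have : x ≤ 3 := by omega
    interval_cases x <;> omega
  subst hx1
  have hd : ∀ v, G.degree v ≤ 4 := by
    intro v
    by_contra! hv
    have := Finset.single_le_sum (f := fun v => if 4 ≤ G.degree v then G.degree v else 0)
      (fun _ _ => Nat.zero_le _) (Finset.mem_univ v)
    simp only [hv.le, if_true] at this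
    omega
  refine ⟨fun v => ?_, ?_, h23, ?_⟩
  · have := hd v
    have := h2 v
    omega
  · rw [degCount_eq, ← hx]
    refine Finset.sum_congr rfl fun v _ => ?_
    have := hd v
    split_ifs <;> omega
  · have := upCount_eq_pairCount_add G 2 4
    omega

open Classical in
-- Connectedness gives an edge leaving the set of vertices of degree below 2; its inner end has a
-- neighbour, so it has degree exactly 1.
theorem two_le_degree_or (G : SimpleGraph V) (hconn : G.Connected) (h3 : ∃ v, 3 ≤ G.degree v) :
    (∀ v, 2 ≤ G.degree v) ∨ 2 * edgeWeight 1 2 ≤ energy G := by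
  refine or_iff_not_imp_left.2 fun h => ?_
  push Not at h
  obtain ⟨v, hv⟩ := h
  obtain ⟨w, hw⟩ := h3
  obtain ⟨a, b, hab, ha, hb⟩ := exists_adj_of_connected hconn
    (p := fun v => G.degree v < 2) hv (b := w) (by omega)
  have ha0 : 0 < G.degree a := (G.degree_pos_iff_exists_adj a).2 ⟨b, hab⟩
  have : 0 < upCount G 1 2 := adjSum_pos G hab (by
    rw [if_pos ⟨by omega, by omega⟩]; exact one_pos)
  have h1 : (1 : ℝ) ≤ upCount G 1 2 := by exact_mod_cast this
  have := upCount_one_le_energy G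
  have := mul_le_mul_of_nonneg_left h1 (edgeWeight_nonneg 1 2)
  linarith

open Classical in
theorem cyclic_trichotomy (G : SimpleGraph V) {c : ℕ} (hc2 : 2 ≤ c) (hc : c ≤ 6)
    (hconn : G.Connected) (hG : G.edgeSet.ncard + 1 = Fintype.card V + c)
    (hn : 2 * c ≤ Fintype.card V + 1) :
    IsBicubicLike G ∨ (4 * edgeWeight 2 3 + 8 * edgeWeight 3 4 ≤ energy G ∧
      (c ≤ 5 → energy G = 4 * edgeWeight 2 3 + 8 * edgeWeight 3 4 → HasQuarticVertex G)) := by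
  obtain ⟨hb, hab, hab4, h12⟩ := edgeWeight_estimates
  have hs := sum_degrees_of_cyclic G hG
  -- The degree sum `2n + 2c - 2` is below `3n` exactly because `n ≥ 2c - 1`.
  have hlow : ∃ v, G.degree v < 3 := by
    by_contra! h
    have : ∑ _v : V, 3 ≤ ∑ v, G.degree v := Finset.sum_le_sum fun v _ => h v
    simp at this
    omega
  have hhigh : ∃ v, 3 ≤ G.degree v := by
    by_contra! h
    have : ∑ v, G.degree v ≤ ∑ _v : V, 2 := Finset.sum_le_sum fun v _ => by
      have := h v
      omega
    simp at this
    omega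
  rcases two_le_degree_or G hconn hhigh with h2 | h
  swap
  · exact Or.inr ⟨by linarith, fun _ h' => by linarith⟩
  have hE := upCount_le_energy G h2
  have hpos : 0 < upCount G 2 3 := by
    obtain ⟨v, hv⟩ := hlow
    obtain ⟨w, hw⟩ := hhigh
    obtain ⟨a, b, hab, ha, hb⟩ := exists_adj_of_connected hconn
      (p := fun v => G.degree v < 3) hv (b := w) (by omega)
    have := h2 a
    exact adjSum_pos G hab (by rw [if_pos ⟨by omega, by omega⟩]; exact one_pos)
  have heven := even_upCount_two G h2
  have hsplit : upCount G 2 3 = pairCount G 2 3 + upCount G 2 4 := upCount_eq_pairCount_add G 2 3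
  have p1 : 0 ≤ edgeWeight 3 4 * upCount G 3 4 := by positivity
  have p2 : 0 ≤ (edgeWeight 2 4 - edgeWeight 2 3) * upCount G 2 4 :=
    mul_nonneg (by linarith) (Nat.cast_nonneg _)
  by_cases hc4 : 4 ≤ upCount G 2 3
  · have : (4 : ℝ) ≤ upCount G 2 3 := by exact_mod_cast hc4
    have := mul_le_mul_of_nonneg_left this (edgeWeight_nonneg 2 3)
    exact Or.inr ⟨by linarith, fun _ h' => by linarith⟩
  have hc2 : upCount G 2 3 = 2 := by
    rw [Nat.even_iff] at heven
    omega
  rw [hc2] at hE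
  push_cast at hE
  by_cases h24 : upCount G 2 4 = 0
  swap
  · have : (1 : ℝ) ≤ upCount G 2 4 := by exact_mod_cast Nat.one_le_iff_ne_zero.2 h24
    have := mul_le_mul_of_nonneg_left this
      (show 0 ≤ edgeWeight 2 4 - edgeWeight 2 3 by linarith)
    exact Or.inr ⟨by linarith, fun _ h' => by linarith⟩
  have h23 : pairCount G 2 3 = 2 := by omega
  by_cases h4 : ∃ v, 4 ≤ G.degree v
  · obtain ⟨h34, hstr⟩ := four_le_upCount G hc hG h2 h23 h24 h4
    have h34' : (4 : ℝ) ≤ upCount G 3 4 := by exact_mod_cast h34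
    have := mul_le_mul_of_nonneg_left h34' hb.le
    refine Or.inr ⟨by linarith, fun hc5 hEq => hstr hc5 (le_antisymm ?_ h34)⟩
    -- A fifth edge from degree 3 upwards would push the energy past the assumed value, since
    -- `w(3,4) > 0`.
    by_contra! h5
    have h5' : (5 : ℝ) ≤ upCount G 3 4 := by exact_mod_cast h5
    have := mul_le_mul_of_nonneg_left h5' hb.le
    linarith
  · push Not at h4
    refine Or.inl ⟨fun v => ?_, h23⟩
    have := h4 v
    have := h2 v
    omega

end Trichotomy



/-! ### Chorded cycles attaining both extremal values. -/

section Construction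

/-- The cycle `0, 1, …, n - 1` together with the chords from `i` to `i + h`, for `i < t`. -/
def chordedCycle (n h t : ℕ) : SimpleGraph (Fin n) :=
  SimpleGraph.fromRel fun i j : Fin n =>
    j.val = i.val + 1 ∨ (i.val = 0 ∧ j.val + 1 = n) ∨ (j.val = i.val + h ∧ i.val < t)

theorem chordedCycle_connected {n : ℕ} (hn : 0 < n) (h t : ℕ) : (chordedCycle n h t).Connected := by
  have key : ∀ k (hk : k < n), (chordedCycle n h t).Reachable ⟨0, hn⟩ ⟨k, hk⟩ := by
    intro k
    induction k with
    | zero => exact fun _ => SimpleGraph.Reachable.refl _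
    | succ k ih =>
      intro hk
      refine (ih (by omega)).trans (SimpleGraph.Adj.reachable ?_)
      simp [chordedCycle]
  have : Nonempty (Fin n) := ⟨⟨0, hn⟩⟩
  exact ⟨fun u v => (key u u.2).symm.trans (key v v.2)⟩

theorem sum_indicator_eq {n : ℕ} (p : Fin n → Prop) [DecidablePred p] (q : Prop) [Decidable q]
    (a : ℕ) (h1 : q → a < n) (h : ∀ w : Fin n, p w ↔ w.val = a ∧ q) :
    ∑ w : Fin n, (if p w then 1 else 0) = if q then 1 else 0 := by
  split_ifs with hq
  · rw [Finset.sum_eq_single (⟨a, h1 hq⟩ : Fin n)]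
    · rw [if_pos ((h _).2 ⟨rfl, hq⟩)]
    · intro b _ hb
      rw [if_neg fun h' => hb (Fin.ext ((h b).1 h').1)]
    · simp
  · exact Finset.sum_eq_zero fun w _ => if_neg fun h' => hq ((h w).1 h').2

open Classical in
-- The four possible neighbours are the two on the cycle and the ends of the chords leaving and
-- entering `v`. The bounds on `h` and `t` keep every chord distinct from the cycle edges, including
-- the closing one.
theorem chordedCycle_degree {n h t : ℕ} (hh : 2 ≤ h) (hn : h + t < n) (v : Fin n) :
    (chordedCycle n h t).degree v =
      2 + (if v.val < t then 1 else 0) + (if h ≤ v.val ∧ v.val < h + t then 1 else 0) := by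
  have hv := v.2
  have e1 := sum_indicator_eq (n := n) (fun w => w.val = if v.val + 1 = n then 0 else v.val + 1)
    True (if v.val + 1 = n then 0 else v.val + 1) (fun _ => by split_ifs <;> omega) (by simp)
  have e2 := sum_indicator_eq (n := n) (fun w => w.val = if v.val = 0 then n - 1 else v.val - 1)
    True (if v.val = 0 then n - 1 else v.val - 1) (fun _ => by split_ifs <;> omega) (by simp)
  have e3 := sum_indicator_eq (n := n) (fun w => w.val = v.val + h ∧ v.val < t)
    (v.val < t) (v.val + h) (fun _ => by omega) (by simp)
  have e4 := sum_indicator_eq (n := n) (fun w => v.val = w.val + h ∧ w.val < t)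
    (h ≤ v.val ∧ v.val < h + t) (v.val - h) (fun _ => by omega) (fun w => by omega)
  rw [if_pos trivial] at e1 e2
  rw [← e3, ← e4]
  refine Eq.trans ?_ (congrArg₂ _ (congrArg₂ _ (congrArg₂ (· + ·) e1 e2) rfl) rfl)
  rw [← Finset.sum_add_distrib, ← Finset.sum_add_distrib, ← Finset.sum_add_distrib,
    ← SimpleGraph.card_neighborFinset_eq_degree, SimpleGraph.neighborFinset_eq_filter,
    Finset.card_filter]
  refine Finset.sum_congr rfl fun w _ => ?_
  have hw := w.2
  simp only [chordedCycle, SimpleGraph.fromRel_adj, ne_eq, Fin.ext_iff]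
  split_ifs <;> omega

theorem sum_ite_lt {n : ℕ} (a b : ℕ) (hb : b ≤ n) :
    ∑ v : Fin n, (if a ≤ v.val ∧ v.val < b then 1 else 0) = b - a := by
  rw [Fin.sum_univ_eq_sum_range (fun k => if a ≤ k ∧ k < b then 1 else 0), Finset.sum_boole,
    Nat.cast_id, ← Nat.card_Ico]
  congr 1
  ext k
  simp only [Finset.mem_filter, Finset.mem_range, Finset.mem_Ico]
  omega

theorem chordedCycle_mem_cyclicGraphs {n h t : ℕ} (hh : 2 ≤ h) (hn : h + t < n) :
    chordedCycle n h t ∈ cyclicGraphs n (t + 1) := by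
  classical
  refine ⟨chordedCycle_connected (by omega) h t, ?_⟩
  have h1 := two_mul_ncard_edgeSet (chordedCycle n h t)
  rw [adjSum_fst] at h1
  simp only [mul_one, Nat.cast_id] at h1
  rw [Finset.sum_congr rfl fun v _ => chordedCycle_degree hh hn v, Finset.sum_add_distrib,
    Finset.sum_add_distrib, sum_ite_lt h (h + t) (by omega)] at h1
  have h2 := sum_ite_lt (n := n) 0 t (by omega)
  simp only [Nat.zero_le, true_and] at h2
  rw [h2] at h1
  simp at h1
  omega

theorem sum_pair_indicator {n : ℕ} (p : Fin n → Fin n → Prop) [∀ u v, Decidable (p u v)]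
    (a b : Fin n × Fin n) (hab : a ≠ b) (hp : ∀ u v, p u v ↔ (u, v) = a ∨ (u, v) = b) :
    ∑ u, ∑ v, (if p u v then 1 else 0) = 2 := by
  rw [← Finset.sum_product', Finset.univ_product_univ, Finset.sum_boole, Nat.cast_id,
    ← Finset.card_pair hab]
  congr 1
  ext ⟨u, v⟩
  simp [hp]

/-- Vertices of degree at least 3 fill the arc `0, …, h + t - 1`, whose two end vertices have degree
3. For `t = h + 1` the vertex `h` both starts and ends a chord, so it has degree 4, and it lies
inside the arc. -/
theorem chordedCycle_pairCount {n h t : ℕ} (hh : 3 ≤ h) (ht : t = h ∨ t = h + 1) (hn : h + t < n) :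
    pairCount (chordedCycle n h t) 2 3 = 2 ∧ pairCount (chordedCycle n h t) 2 4 = 0 := by
  classical
  constructor
  · refine Eq.trans ?_ (sum_pair_indicator (n := n)
      (fun u v => (u.val = h + t ∧ v.val + 1 = h + t) ∨ (u.val + 1 = n ∧ v.val = 0))
      (⟨h + t, hn⟩, ⟨h + t - 1, by omega⟩) (⟨n - 1, by omega⟩, ⟨0, by omega⟩)
      (by simp only [ne_eq, Prod.mk.injEq, Fin.mk.injEq]; omega)
      (fun u v => by simp only [Prod.mk.injEq, Fin.ext_iff]; omega))
    unfold pairCount adjSum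
    refine Finset.sum_congr rfl fun u _ => Finset.sum_congr rfl fun v _ => ?_
    rw [chordedCycle_degree (by omega) hn, chordedCycle_degree (by omega) hn, ← ite_and]
    refine if_congr ?_ rfl rfl
    have hu := u.2
    have hv := v.2
    simp only [chordedCycle, SimpleGraph.fromRel_adj, ne_eq, Fin.ext_iff]
    split_ifs <;> omega
  · unfold pairCount adjSum
    refine Finset.sum_eq_zero fun u _ => Finset.sum_eq_zero fun v _ => ?_
    rw [chordedCycle_degree (by omega) hn, chordedCycle_degree (by omega) hn, ← ite_and]
    refine if_neg ?_
    have hu := u.2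
    have hv := v.2
    simp only [chordedCycle, SimpleGraph.fromRel_adj, ne_eq, Fin.ext_iff]
    split_ifs <;> omega

theorem chordedCycle_isBicubicLike {n h : ℕ} (hh : 3 ≤ h) (hn : 2 * h < n) :
    IsBicubicLike (chordedCycle n h h) := by
  refine ⟨fun v => ?_, (chordedCycle_pairCount hh (Or.inl rfl) (by omega)).1⟩
  rw [chordedCycle_degree (by omega) (by omega)]
  split_ifs <;> omega

theorem chordedCycle_hasQuarticVertex {n h : ℕ} (hh : 3 ≤ h) (hn : 2 * h + 1 < n) :
    HasQuarticVertex (chordedCycle n h (h + 1)) := by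
  classical
  obtain ⟨h1, h2⟩ := chordedCycle_pairCount (n := n) hh (Or.inr rfl) (by omega)
  refine ⟨fun v => ?_, ?_, h1, h2⟩
  · rw [chordedCycle_degree (by omega) (by omega)]
    split_ifs <;> omega
  · rw [degCount_eq]
    have := sum_indicator_eq (n := n) (fun v => v.val = h) True h (fun _ => by omega) (by simp)
    rw [if_pos trivial] at this
    refine Eq.trans ?_ this
    refine Finset.sum_congr rfl fun v _ => ?_
    rw [chordedCycle_degree (by omega) (by omega)]
    refine if_congr ?_ rfl rfl
    split_ifs <;> omega

end Construction

/-! ### From energy to extremal graphs and the sets Ω. -/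

section Extremal

variable {n c : ℕ}

theorem four_mul_randicIndex_of_cyclic (hn : 2 ≤ n) {G : SimpleGraph (Fin n)}
    (hG : G ∈ cyclicGraphs n c) : 4 * randicIndex G = 2 * n - energy G := by
  classical
  have : Nontrivial (Fin n) := Fin.nontrivial_iff_two_le.2 hn
  rw [four_mul_randicIndex G, Fintype.card_fin]
  intro v
  convert hG.1.preconnected.degree_pos_of_nontrivial v

theorem randicIndex_le_iff (hn : 2 ≤ n) {G H : SimpleGraph (Fin n)}
    (hG : G ∈ cyclicGraphs n c) (hH : H ∈ cyclicGraphs n c) :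
    randicIndex H ≤ randicIndex G ↔ energy G ≤ energy H := by
  have h1 := four_mul_randicIndex_of_cyclic hn hG
  have h2 := four_mul_randicIndex_of_cyclic hn hH
  constructor <;> intro h <;> linarith

theorem energy_dichotomy (hc2 : 2 ≤ c) (hc : c ≤ 6) (hn : 2 * c ≤ n + 1)
    {G : SimpleGraph (Fin n)} (hG : G ∈ cyclicGraphs n c) :
    IsBicubicLike G ∨ (4 * edgeWeight 2 3 + 8 * edgeWeight 3 4 ≤ energy G ∧
      (c ≤ 5 → energy G = 4 * edgeWeight 2 3 + 8 * edgeWeight 3 4 → HasQuarticVertex G)) :=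
  cyclic_trichotomy G hc2 hc hG.1 (by rw [Fintype.card_fin]; exact hG.2)
    (by rw [Fintype.card_fin]; exact hn)

theorem IsBicubicLike.energy_eq {G : SimpleGraph (Fin n)} (h : IsBicubicLike G)
    (hG : G ∈ cyclicGraphs n c) : energy G = 4 * edgeWeight 2 3 :=
  (h.counts (c := c) (by rw [Fintype.card_fin]; exact hG.2)).2.2.2.2.2

theorem HasQuarticVertex.energy_eq {G : SimpleGraph (Fin n)} (h : HasQuarticVertex G)
    (hG : G ∈ cyclicGraphs n c) : energy G = 4 * edgeWeight 2 3 + 8 * edgeWeight 3 4 :=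
  (h.counts (c := c) (by rw [Fintype.card_fin]; exact hG.2)).2.2.2.2.2.2.2

theorem isBicubicLike_iff_hasMaxRandic (hc2 : 4 ≤ c) (hc : c ≤ 6) (hn : 2 * c ≤ n + 1)
    {G : SimpleGraph (Fin n)} (hG : G ∈ cyclicGraphs n c) :
    IsBicubicLike G ↔ HasMaxRandic (cyclicGraphs n c) G := by
  have hb := edgeWeight_estimates.1
  constructor
  · refine fun h => ⟨hG, fun H hH => ?_⟩
    rw [randicIndex_le_iff (by omega) hG hH, h.energy_eq hG]
    rcases energy_dichotomy (by omega) hc hn hH with h' | ⟨h', -⟩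
    · exact (h'.energy_eq hH).ge
    · linarith
  · rintro ⟨-, h⟩
    obtain ⟨t, rfl⟩ : ∃ t, c = t + 1 := ⟨c - 1, by omega⟩
    -- An explicit competitor of energy `4 w(2,3)` rules out any maximizer of the second kind.
    have hK := chordedCycle_mem_cyclicGraphs (n := n) (h := t) (t := t) (by omega) (by omega)
    have hK' := chordedCycle_isBicubicLike (n := n) (h := t) (by omega) (by omega)
    have hle := (randicIndex_le_iff (by omega) hG hK).1 (h _ hK)
    rw [hK'.energy_eq hK] at hle
    rcases energy_dichotomy (by omega) hc hn hG with h' | ⟨h', -⟩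
    · exact h'
    · linarith

theorem HasQuarticVertex.hasSecondMaxRandic (hc2 : 4 ≤ c) (hc : c ≤ 6) (hn : 2 * c ≤ n + 1)
    {G : SimpleGraph (Fin n)} (hG : G ∈ cyclicGraphs n c) (h : HasQuarticVertex G) :
    HasSecondMaxRandic (cyclicGraphs n c) G := by
  have hb := edgeWeight_estimates.1
  have hE := h.energy_eq hG
  refine ⟨⟨hG, fun hmax => ?_⟩, ?_⟩
  · rw [← isBicubicLike_iff_hasMaxRandic hc2 hc hn hG] at hmax
    have := hmax.energy_eq hG
    linarith
  · rintro H ⟨hH, hmax⟩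
    rw [← isBicubicLike_iff_hasMaxRandic hc2 hc hn hH] at hmax
    rw [randicIndex_le_iff (by omega) hG hH, hE]
    exact ((energy_dichotomy (by omega) hc hn hH).resolve_left hmax).1

/-- A chorded cycle with a quartic vertex attains the lower bound for non-maximizers, so a second
maximizer attains it too; the equality case is then available because `c ≤ 5`. -/
theorem hasQuarticVertex_of_hasSecondMaxRandic (hc2 : 5 ≤ c) (hc : c ≤ 5) (hn : 2 * c ≤ n + 1)
    {G : SimpleGraph (Fin n)} (h : HasSecondMaxRandic (cyclicGraphs n c) G) :
    HasQuarticVertex G := by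
  obtain ⟨⟨hG, hmax⟩, h⟩ := h
  rw [← isBicubicLike_iff_hasMaxRandic (by omega) (by omega) hn hG] at hmax
  obtain ⟨h1, h2⟩ := (energy_dichotomy (by omega) (by omega) hn hG).resolve_left hmax
  obtain ⟨t, rfl⟩ : ∃ t, c = t + 2 := ⟨c - 2, by omega⟩
  have hK := chordedCycle_mem_cyclicGraphs (n := n) (h := t) (t := t + 1) (by omega) (by omega)
  have hK' := chordedCycle_hasQuarticVertex (n := n) (h := t) (by omega) (by omega)
  have hle := (randicIndex_le_iff (by omega) hG hK).1
    (h _ (hK'.hasSecondMaxRandic (by omega) (by omega) hn hK).1)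
  rw [hK'.energy_eq hK] at hle
  exact h2 hc (le_antisymm hle h1)

/-- Within the cyclic class the degree counts and `m₂₃ = 2` already imply the other edge counts. -/
theorem mem_Omega1_iff {G : SimpleGraph (Fin n)} (hG : G ∈ cyclicGraphs n 5) :
    G ∈ Omega1 n ↔ IsBicubicLike G := by
  constructor
  · rintro ⟨⟨h1, h2⟩, -, h3, -⟩
    exact isBicubicLike_of_counts (by rw [Fintype.card_fin]; omega) h3
  · intro h
    have := h.counts (c := 5) (by rw [Fintype.card_fin]; exact hG.2)
    rw [Fintype.card_fin] at this
    exact ⟨⟨by omega, by omega⟩, by omega, by omega, by omega⟩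

theorem mem_Omega3_iff {G : SimpleGraph (Fin n)} (hG : G ∈ cyclicGraphs n 6) :
    G ∈ Omega3 n ↔ IsBicubicLike G := by
  constructor
  · rintro ⟨⟨h1, h2⟩, -, h3, -⟩
    exact isBicubicLike_of_counts (by rw [Fintype.card_fin]; omega) h3
  · intro h
    have := h.counts (c := 6) (by rw [Fintype.card_fin]; exact hG.2)
    rw [Fintype.card_fin] at this
    exact ⟨⟨by omega, by omega⟩, by omega, by omega, by omega⟩

theorem mem_Omega5_iff {G : SimpleGraph (Fin n)} (hG : G ∈ cyclicGraphs n 5) :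
    G ∈ Omega5 n ↔ HasQuarticVertex G := by
  constructor
  · rintro ⟨⟨-, h4, h3, h2⟩, h43, -, h23, -⟩
    exact hasQuarticVertex_of_counts (by rw [Fintype.card_fin]; omega) h4 h23 h43
  · intro h
    have := h.counts (c := 5) (by rw [Fintype.card_fin]; exact hG.2)
    rw [Fintype.card_fin] at this
    exact ⟨⟨by omega, h.2.1, by omega, by omega⟩, by omega, by omega, by omega, by omega⟩

theorem mem_Omega7_iff {G : SimpleGraph (Fin n)} (hG : G ∈ cyclicGraphs n 6) :
    G ∈ Omega7 n ↔ HasQuarticVertex G := by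
  constructor
  · rintro ⟨⟨-, h4, h3, h2⟩, h43, -, h23, -⟩
    exact hasQuarticVertex_of_counts (by rw [Fintype.card_fin]; omega) h4 h23 h43
  · intro h
    have := h.counts (c := 6) (by rw [Fintype.card_fin]; exact hG.2)
    rw [Fintype.card_fin] at this
    exact ⟨⟨by omega, h.2.1, by omega, by omega⟩, by omega, by omega, by omega, by omega⟩

end Extremal

end RandicCyclic

theorem mainTheorem6 (n : ℕ) :
    (9 ≤ n →
      (∃ G ∈ RandicCyclic.cyclicGraphs n 5, G ∈ RandicCyclic.Omega1 n) ∧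
      (∃ G ∈ RandicCyclic.cyclicGraphs n 5, G ∈ RandicCyclic.Omega5 n) ∧
      (∀ G ∈ RandicCyclic.cyclicGraphs n 5,
        (G ∈ RandicCyclic.Omega1 n ↔
          RandicCyclic.HasMaxRandic (RandicCyclic.cyclicGraphs n 5) G) ∧
        (G ∈ RandicCyclic.Omega5 n ↔
          RandicCyclic.HasSecondMaxRandic (RandicCyclic.cyclicGraphs n 5) G))) ∧
    (11 ≤ n →
      (∃ G ∈ RandicCyclic.cyclicGraphs n 6, G ∈ RandicCyclic.Omega3 n) ∧
      (∃ G ∈ RandicCyclic.cyclicGraphs n 6, G ∈ RandicCyclic.Omega7 n) ∧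
      (∀ G ∈ RandicCyclic.cyclicGraphs n 6,
        (G ∈ RandicCyclic.Omega3 n ↔
          RandicCyclic.HasMaxRandic (RandicCyclic.cyclicGraphs n 6) G) ∧
        (G ∈ RandicCyclic.Omega7 n →
          RandicCyclic.HasSecondMaxRandic (RandicCyclic.cyclicGraphs n 6) G))) := by
  open RandicCyclic in
  refine ⟨fun hn => ?_, fun hn => ?_⟩
  · have hA := chordedCycle_mem_cyclicGraphs (n := n) (h := 4) (t := 4) (by omega) (by omega)
    have hB := chordedCycle_mem_cyclicGraphs (n := n) (h := 3) (t := 4) (by omega) (by omega)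
    refine ⟨⟨_, hA, (mem_Omega1_iff hA).2 (chordedCycle_isBicubicLike (by omega) (by omega))⟩,
      ⟨_, hB, (mem_Omega5_iff hB).2 (chordedCycle_hasQuarticVertex (by omega) (by omega))⟩,
      fun G hG => ⟨?_, ?_, fun h => ?_⟩⟩
    · rw [mem_Omega1_iff hG]
      exact isBicubicLike_iff_hasMaxRandic (by omega) (by omega) (by omega) hG
    · rw [mem_Omega5_iff hG]
      exact HasQuarticVertex.hasSecondMaxRandic (by omega) (by omega) (by omega) hG
    · rw [mem_Omega5_iff hG]
      exact hasQuarticVertex_of_hasSecondMaxRandic le_rfl le_rfl (by omega) h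
  · have hA := chordedCycle_mem_cyclicGraphs (n := n) (h := 5) (t := 5) (by omega) (by omega)
    have hB := chordedCycle_mem_cyclicGraphs (n := n) (h := 4) (t := 5) (by omega) (by omega)
    refine ⟨⟨_, hA, (mem_Omega3_iff hA).2 (chordedCycle_isBicubicLike (by omega) (by omega))⟩,
      ⟨_, hB, (mem_Omega7_iff hB).2 (chordedCycle_hasQuarticVertex (by omega) (by omega))⟩,
      fun G hG => ⟨?_, fun h => ?_⟩⟩
    · rw [mem_Omega3_iff hG]
      exact isBicubicLike_iff_hasMaxRandic (by omega) (by omega) (by omega) hG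
    · rw [mem_Omega7_iff hG] at h
      exact h.hasSecondMaxRandic (by omega) (by omega) (by omega) hG
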